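/- Let $d\in\mathbb N$ and let $P$ be a probability measure on $\mathbb R^d$ with Lebesgue density $p\in W^{2,1}(\mathbb R^d)\cap W^{2,2}(\mathbb R^d)$. Let $K\colon\mathbb R^d\to[0,\infty)$ satisfy $K\in L^1(\mathbb R^d)\cap L^2(\mathbb R^d)$, $\int K(u)\,du=1$, $\int u\,K(u)\,du=0$ and $\int\|u\|^2K(u)\,du<\infty$, and let the bandwidths $h_N>0$ satisfy $h_N\to0$ and $Nh_N^d\to\infty$ as $N\to\infty$. Put $$K_h(x,y)=\frac1{h^d}K\Big(\frac{x-y}h\Big),\qquad \hat q_N(x)=\frac1N\sum_{k=1}^N K_{h_N}(x,Z_k),\qquad \mathbb E_P[K_h(x,\cdot)]=\int K_h(x,z)\,P(dz).$$ Assume that the $Z_k$ are either i.i.d. with law $P$, or form a stationary time-homogeneous Markov chain in $\mathbb R^d$ with transition kernel $T$ and invariant distribution $P$ such that the spectral gap $\gamma$ or the pseudo spectral gap $\gamma_{\mathrm{ps}}$ is positive. Here $T$ acts on $L^2_0(P)=\{f\in L^2(P;\mathbb C):\int f\,dP=0\}$ by $(Tf)(x)=\int f(y)\,T(x,dy)$,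 with adjoint $T^*$; for a bounded operator $A$ on $L^2_0(P)$ put $\gamma(A)=1-\sup\{\operatorname{Re}\lambda:\lambda\in\sigma(A)\}$; and $\gamma=\gamma(T)$, $\gamma_{\mathrm{ps}}=\sup_{k\ge1}\gamma\big((T^*)^kT^k\big)/k$. Then there is a constant $C_{\mathrm{mc}}>0$, depending on the law of the sequence $(Z_k)$ but not on $K$, on the bandwidths or on $N$, such that for all $N\ge1$, with $h=h_N$, $$\int_{\mathbb R^d}\mathbb E\big[(\hat q_N(x)-\mathbb E_P[K_h(x,\cdot)])^2\big]\,dx\le\frac{C_{\mathrm{mc}}}{Nh^d}\|K\|_{L^2(\mathbb R^d)}^2=\mathcal O\Big(\frac1{Nh_N^d}\Big).$$ Moreover, if for certain constants $m>2d$ and $C_p>0$ $$M_{K,m}:=\int_{\mathbb R^d}(1+\|u\|)^mK(u)^2\,du<\infty\qquad\text{and}\qquad p(x)\le C_p(1+\|x\|)^{-m}\ \text{ for almost every }x\in\mathbb R^d,$$ then $C_1:=\sqrt{C_{\mathrm{mc}}C_pM_{K,m}}\int_{\mathbb R^d}(1+\|x\|)^{-m/2}\,dx<\infty$, for all $N\ge1$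 with $h=h_N<1$ $$\int_{\mathbb R^d}\mathbb E\big[|\hat q_N(x)-\mathbb E_P[K_h(x,\cdot)]|\big]\,dx\le\frac{C_1}{\sqrt N\,h^{d/2}},$$ and the left-hand side is $\mathcal O\big(1/(\sqrt N\,h_N^{d/2})\big)$ as $N\to\infty$. -/

import Mathlib

open MeasureTheory ProbabilityTheory Filter Topology Asymptotics
open scoped ENNReal

noncomputable section

/-! ### Sobolev spaces -/

/-- `g` is the weak partial derivative of `f` in the `i`-th coordinate direction. -/
def HasWeakPartial {d : ℕ} (i : Fin d) (f g : EuclideanSpace ℝ (Fin d) → ℝ) : Prop :=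
  ∀ φ : EuclideanSpace ℝ (Fin d) → ℝ, ContDiff ℝ (⊤ : ℕ∞) φ → HasCompactSupport φ →
    ∫ x, f x * fderiv ℝ φ x (EuclideanSpace.single i 1) = -∫ x, g x * φ x

/-- `f ∈ W^{k,q}(ℝ^d)`: all weak partial derivatives of `f` up to order `k` lie in `L^q`. -/
def MemW {d : ℕ} : ℕ → ℝ≥0∞ → (EuclideanSpace ℝ (Fin d) → ℝ) → Prop
  | 0, q, f => MemLp f q volume
  | k + 1, q, f => MemLp f q volume ∧ ∀ i : Fin d, ∃ g, HasWeakPartial i f g ∧ MemW k q g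

/-! ### Assumptions on the density, the kernel and the bandwidth -/

/-- `p` is the Lebesgue density of `P`, and `p ∈ W^{2,1}(ℝ^d) ∩ W^{2,2}(ℝ^d)`. -/
structure IsSobolevDensity {d : ℕ} (P : Measure (EuclideanSpace ℝ (Fin d)))
    (p : EuclideanSpace ℝ (Fin d) → ℝ) : Prop where
  nonneg : 0 ≤ᵐ[volume] p
  density : P = volume.withDensity (fun x => ENNReal.ofReal (p x))
  memW_one : MemW 2 1 p
  memW_two : MemW 2 2 p

/-- The smoothing kernel: nonnegative, in `L¹ ∩ L²`, of total mass one, with vanishing first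
moment and finite second moment. -/
structure IsSmoothingKernel {d : ℕ} (K : EuclideanSpace ℝ (Fin d) → ℝ) : Prop where
  nonneg : ∀ u, 0 ≤ K u
  memLp_one : MemLp K 1 volume
  memLp_two : MemLp K 2 volume
  integral_eq_one : ∫ u, K u = 1
  first_moment : ∫ u, K u • u = 0
  second_moment : Integrable (fun u => ‖u‖ ^ 2 * |K u|) volume

/-- The bandwidth sequence: `h_N > 0`, `h_N → 0` and `N h_N^d → ∞`. -/
structure IsBandwidth (d : ℕ) (h : ℕ → ℝ) : Prop where
  pos : ∀ N, 0 < h N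
  tendsto_zero : Tendsto h atTop (𝓝 0)
  tendsto_atTop : Tendsto (fun N : ℕ => (N : ℝ) * h N ^ d) atTop atTop

/-! ### The kernel density estimator -/

/-- `K_h(x, y) = h^{-d} K((x - y) / h)`. -/
def scaledKernel {d : ℕ} (K : EuclideanSpace ℝ (Fin d) → ℝ) (h : ℝ)
    (x y : EuclideanSpace ℝ (Fin d)) : ℝ :=
  1 / h ^ d * K (h⁻¹ • (x - y))

/-- The estimator `q̂_N(x) = N⁻¹ ∑_k K_h(x, Z_k)` for the outcome `ω`, built on the first `N`
terms `Z 0, …, Z (N - 1)` of the sequence `Z`. -/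
def kde {d : ℕ} {Ω : Type*} (K : EuclideanSpace ℝ (Fin d) → ℝ) (h : ℝ)
    (Z : ℕ → Ω → EuclideanSpace ℝ (Fin d)) (N : ℕ) (ω : Ω) (x : EuclideanSpace ℝ (Fin d)) : ℝ :=
  1 / (N : ℝ) * ∑ k ∈ Finset.range N, scaledKernel K h x (Z k ω)

/-- The stochastic fluctuation `q̂_N(x) - E_P[K_h(x, ·)]`. -/
def kdeDeviation {d : ℕ} {Ω : Type*} (P : Measure (EuclideanSpace ℝ (Fin d)))
    (K : EuclideanSpace ℝ (Fin d) → ℝ) (h : ℝ)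
    (Z : ℕ → Ω → EuclideanSpace ℝ (Fin d)) (N : ℕ) (ω : Ω) (x : EuclideanSpace ℝ (Fin d)) : ℝ :=
  kde K h Z N ω x - ∫ z, scaledKernel K h x z ∂P

/-- The integrated variance `∫ E[(q̂_N(x) - E_P[K_h(x, ·)])²] dx`, with values in `[0, ∞]`. -/
def integratedVariance {d : ℕ} {Ω : Type*} [MeasurableSpace Ω] (μ : Measure Ω)
    (P : Measure (EuclideanSpace ℝ (Fin d))) (K : EuclideanSpace ℝ (Fin d) → ℝ) (h : ℝ)
    (Z : ℕ → Ω → EuclideanSpace ℝ (Fin d)) (N : ℕ) : ℝ≥0∞ :=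
  ∫⁻ x, ∫⁻ ω, ENNReal.ofReal (kdeDeviation P K h Z N ω x ^ 2) ∂μ

/-- The integrated mean absolute deviation `∫ E[|q̂_N(x) - E_P[K_h(x, ·)]|] dx`, with values
in `[0, ∞]`. -/
def integratedMAD {d : ℕ} {Ω : Type*} [MeasurableSpace Ω] (μ : Measure Ω)
    (P : Measure (EuclideanSpace ℝ (Fin d))) (K : EuclideanSpace ℝ (Fin d) → ℝ) (h : ℝ)
    (Z : ℕ → Ω → EuclideanSpace ℝ (Fin d)) (N : ℕ) : ℝ≥0∞ :=
  ∫⁻ x, ∫⁻ ω, ENNReal.ofReal |kdeDeviation P K h Z N ω x| ∂μ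

/-! ### The Markov operator on `L²(P)` and its spectral gaps -/

section MarkovOperator

variable {E : Type*} [MeasurableSpace E] {T : Kernel E E} {P : Measure E}

theorem lintegral_markov (hT : T.Invariant P) {g : E → ℝ≥0∞} (hg : Measurable g) :
    ∫⁻ x, ∫⁻ y, g y ∂T x ∂P = ∫⁻ y, g y ∂P := by
  conv_rhs => rw [← hT.def]
  rw [Measure.lintegral_bind T.aemeasurable hg.aemeasurable]

theorem ae_ae_markov (hT : T.Invariant P) {q : E → Prop} (h : ∀ᵐ y ∂P, q y) :
    ∀ᵐ x ∂P, ∀ᵐ y ∂T x, q y := by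
  rw [← hT.def] at h
  exact Measure.ae_ae_of_ae_bind T.aemeasurable h

theorem eLpNorm_markov_le [IsMarkovKernel T] (hT : T.Invariant P) {f : E → ℂ} (hf : StronglyMeasurable f) :
    eLpNorm (fun x => ∫ y, f y ∂T x) 2 P ≤ eLpNorm f 2 P := by
  have key : ∀ x, ‖∫ y, f y ∂T x‖ₑ ^ (2 : ℝ) ≤ ∫⁻ y, ‖f y‖ₑ ^ (2 : ℝ) ∂T x := by
    intro x
    have h1 : ‖∫ y, f y ∂T x‖ₑ ≤ eLpNorm f 2 (T x) := by
      refine (enorm_integral_le_lintegral_enorm f).trans ?_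
      rw [← eLpNorm_one_eq_lintegral_enorm]
      exact eLpNorm_le_eLpNorm_of_exponent_le (by norm_num) hf.aestronglyMeasurable
    calc ‖∫ y, f y ∂T x‖ₑ ^ (2 : ℝ) ≤ (eLpNorm f 2 (T x)) ^ (2 : ℝ) := by gcongr
      _ = ∫⁻ y, ‖f y‖ₑ ^ (2 : ℝ) ∂T x := by
        rw [eLpNorm_eq_lintegral_rpow_enorm_toReal (by norm_num) (by norm_num),
          ← ENNReal.rpow_mul]
        norm_num
  rw [eLpNorm_eq_lintegral_rpow_enorm_toReal (by norm_num) (by norm_num),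
    eLpNorm_eq_lintegral_rpow_enorm_toReal (by norm_num) (by norm_num)]
  have h2 : (2 : ℝ≥0∞).toReal = 2 := by norm_num
  rw [h2, ← lintegral_markov hT (g := fun y => ‖f y‖ₑ ^ (2 : ℝ))
    (hf.measurable.enorm.pow_const _)]
  gcongr with x
  exact key x

theorem memLp_markov [IsMarkovKernel T] (hT : T.Invariant P) (f : Lp ℂ 2 P) :
    MemLp (fun x => ∫ y, f y ∂T x) 2 P :=
  ⟨(Lp.stronglyMeasurable f).integral_kernel.aestronglyMeasurable,
    (eLpNorm_markov_le hT (Lp.stronglyMeasurable f)).trans_lt (Lp.memLp f).2⟩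

variable [IsProbabilityMeasure P]

theorem ae_integrable_markov (hT : T.Invariant P) (f : Lp ℂ 2 P) :
    ∀ᵐ x ∂P, Integrable f (T x) := by
  have h1 : ∫⁻ x, ∫⁻ y, ‖f y‖ₑ ∂T x ∂P ≠ ∞ := by
    rw [lintegral_markov hT (Lp.stronglyMeasurable f).measurable.enorm]
    exact ((Lp.memLp f).integrable (by norm_num)).2.ne
  filter_upwards [ae_lt_top (Lp.stronglyMeasurable f).measurable.enorm.lintegral_kernel h1]
    with x hx
  exact ⟨(Lp.stronglyMeasurable f).aestronglyMeasurable, hx⟩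

/-- The Markov operator `(T f)(x) = ∫ f(y) T(x, dy)` on the complex Hilbert space `L²(P)`, where
`P` is invariant under the transition kernel `T`. -/
def markovOp (T : Kernel E E) [IsMarkovKernel T] (P : Measure E) [IsProbabilityMeasure P]
    (hT : T.Invariant P) : Lp ℂ 2 P →L[ℂ] Lp ℂ 2 P :=
  LinearMap.mkContinuous
    { toFun := fun f => (memLp_markov hT f).toLp _
      map_add' := by
        intro f g
        rw [← MemLp.toLp_add]
        refine (MemLp.toLp_eq_toLp_iff _ _).2 ?_
        filter_upwards [ae_integrable_markov hT f, ae_integrable_markov hT g,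
          ae_ae_markov hT (Lp.coeFn_add f g)] with x hf hg h
        rw [integral_congr_ae h]
        exact integral_add hf hg
      map_smul' := by
        intro c f
        simp only [RingHom.id_apply]
        rw [← MemLp.toLp_const_smul]
        refine (MemLp.toLp_eq_toLp_iff _ _).2 ?_
        filter_upwards [ae_ae_markov hT (Lp.coeFn_smul c f)] with x h
        rw [integral_congr_ae h]
        exact integral_smul c _ }
    1 (by
      intro f
      simp only [LinearMap.coe_mk, AddHom.coe_mk, one_mul]
      rw [Lp.norm_toLp, Lp.norm_def]
      exact ENNReal.toReal_mono (Lp.memLp f).2.ne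
        (eLpNorm_markov_le hT (Lp.stronglyMeasurable f)))

theorem markovOp_ae [IsMarkovKernel T] (hT : T.Invariant P) (f : Lp ℂ 2 P) :
    markovOp T P hT f =ᵐ[P] fun x => ∫ y, f y ∂T x :=
  (memLp_markov hT f).coeFn_toLp

/-- `L²₀(P)`: the orthogonal complement of the constant functions in `L²(P)`. -/
def L2Zero (P : Measure E) [IsProbabilityMeasure P] : Submodule ℂ (Lp ℂ 2 P) :=
  (Submodule.span ℂ {(memLp_const (μ := P) (p := 2) (1 : ℂ)).toLp _})ᗮ

instance (P : Measure E) [IsProbabilityMeasure P] : CompleteSpace (L2Zero P) :=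
  inferInstanceAs (CompleteSpace (Submodule.span ℂ _)ᗮ)

theorem mem_L2Zero_iff (f : Lp ℂ 2 P) : f ∈ L2Zero P ↔ ∫ x, f x ∂P = 0 := by
  rw [L2Zero, Submodule.mem_orthogonal_singleton_iff_inner_right, L2.inner_def]
  have : ∫ x, inner ℂ (((memLp_const (μ := P) (p := 2) (1 : ℂ)).toLp _ : Lp ℂ 2 P) x) (f x) ∂P
      = ∫ x, f x ∂P := by
    refine integral_congr_ae ?_
    filter_upwards [(memLp_const (μ := P) (p := 2) (1 : ℂ)).coeFn_toLp] with x hx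
    rw [hx]
    simp
  rw [this]

theorem integral_markovOp [IsMarkovKernel T] (hT : T.Invariant P) (f : Lp ℂ 2 P) :
    ∫ x, markovOp T P hT f x ∂P = ∫ x, f x ∂P := by
  rw [integral_congr_ae (markovOp_ae hT f)]
  have hc : (T ∘ₖ Kernel.const Unit P) () = P := by
    rw [Kernel.comp_const, hT.def, Kernel.const_apply]
  have hint : Integrable f ((T ∘ₖ Kernel.const Unit P) ()) := by
    rw [hc]
    exact (Lp.memLp f).integrable (by norm_num)
  have h := Kernel.integral_comp hint
  rw [hc, Kernel.const_apply] at h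
  exact h.symm

theorem mapsTo_L2Zero [IsMarkovKernel T] (hT : T.Invariant P) :
    ∀ f ∈ L2Zero P, markovOp T P hT f ∈ L2Zero P := by
  intro f hf
  rw [mem_L2Zero_iff] at hf ⊢
  rw [integral_markovOp hT, hf]

/-- The restriction of the Markov operator to `L²₀(P)`. -/
def markovOpZero (T : Kernel E E) [IsMarkovKernel T] (P : Measure E) [IsProbabilityMeasure P]
    (hT : T.Invariant P) : L2Zero P →L[ℂ] L2Zero P :=
  (markovOp T P hT).restrict (mapsTo_L2Zero hT)

/-- The gap `1 - sup {Re λ : λ ∈ σ(A)}` of an operator on `L²₀(P)`. For self-adjoint `A` the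
spectrum is real and this is the usual `1 - sup σ(A)`. -/
def operatorGap {P : Measure E} [IsProbabilityMeasure P] (A : L2Zero P →L[ℂ] L2Zero P) : ℝ :=
  1 - sSup (Complex.re '' spectrum ℂ A)

/-- The spectral gap `γ` of the transition kernel `T` with invariant distribution `P`. -/
def spectralGap (T : Kernel E E) [IsMarkovKernel T] (P : Measure E) [IsProbabilityMeasure P]
    (hT : T.Invariant P) : ℝ :=
  operatorGap (markovOpZero T P hT)

/-- The pseudo spectral gap `γ_ps = sup_{k ≥ 1} γ((T*)^k T^k) / k`. -/
def pseudoSpectralGap (T : Kernel E E) [IsMarkovKernel T] (P : Measure E)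
    [IsProbabilityMeasure P] (hT : T.Invariant P) : ℝ :=
  ⨆ k : ℕ+, operatorGap
    ((ContinuousLinearMap.adjoint (markovOpZero T P hT)) ^ (k : ℕ)
      * (markovOpZero T P hT) ^ (k : ℕ)) / (k : ℝ)

end MarkovOperator

/-! ### Assumptions on the data -/

/-- `Z` is a time-homogeneous Markov chain with transition kernel `T`:
`μ(Z_{n+1} ∈ A | Z_0, …, Z_n) = T(Z_n, A)` almost surely. -/
structure IsMarkovChain {E Ω : Type*} [MeasurableSpace E] [MeasurableSpace Ω]
    (T : Kernel E E) (Z : ℕ → Ω → E) (μ : Measure Ω) : Prop where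
  measurable : ∀ n, Measurable (Z n)
  markov : ∀ (n : ℕ) (A : Set E), MeasurableSet A →
    μ⟦Z (n + 1) ⁻¹' A | ⨆ j ≤ n, MeasurableSpace.comap (Z j) inferInstance⟧
      =ᵐ[μ] fun ω => (T (Z n ω)).real A

/-- `Z_0, Z_1, …` are i.i.d. with law `P`. -/
def IsIIDSample {E Ω : Type*} [MeasurableSpace E] [MeasurableSpace Ω]
    (Z : ℕ → Ω → E) (P : Measure E) (μ : Measure Ω) : Prop :=
  (∀ n, Measurable (Z n)) ∧ (∀ n, μ.map (Z n) = P) ∧ iIndepFun Z μ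

/-- `Z` is a Markov chain with invariant distribution `P`, started in `P`, that has a spectral gap
`γ > 0` or a pseudo spectral gap `γ_ps > 0`. -/
def IsStationaryChainWithGap {E Ω : Type*} [MeasurableSpace E] [MeasurableSpace Ω]
    (Z : ℕ → Ω → E) (P : Measure E) [IsProbabilityMeasure P] (μ : Measure Ω) : Prop :=
  ∃ (T : Kernel E E) (_ : IsMarkovKernel T) (hT : T.Invariant P),
    IsMarkovChain T Z μ ∧ μ.map (Z 0) = P ∧
      (0 < spectralGap T P hT ∨ 0 < pseudoSpectralGap T P hT)

end

/-! ### Sums along a sequence of isometries -/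

section Hilbert

variable {F H : Type*} [NormedAddCommGroup F] [InnerProductSpace ℂ F]
  [NormedAddCommGroup H] [InnerProductSpace ℂ H]

/-! Everything rests on one variance bound: for centred `f` in `L²₀(P)`, the sum of `f(Z_k)` over `k
< N` has squared `L²(μ)` norm at most `C N ‖f‖²`, with `C` depending only on the law of the sample.
By stationarity, `f ↦ f(Z_k)` is an isometry, and the Markov property turns correlations at lag `n`
into `⟪f, T^n f⟫`. Summed over lags these form a geometric series, which telescopes to a bounded
operator as soon as `1 - T` has a bounded inverse `R` on `L²₀(P)`; this gives `C = 1 + 4‖R‖`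
(`norm_sum_isometry_sq_le`).

A gap enters only through this invertibility (`isUnit_one_sub_markovOpZero`). If `γ > 0`, then 1 is
not in the spectrum of `T`. If `γ_ps > 0`, some power satisfies `‖T^k‖ < 1`, and `1 - T` is a factor
of the invertible `1 - T^k`. The i.i.d. case is the same computation with `T = 0`.

For fixed `x`, the bound is applied to the centred function `K_h(x, ·)`. Integrating over `x` by
Tonelli gives `h^{-d} ‖K‖²`. For the absolute deviation, Cauchy–Schwarz in `ω` leaves the square
root of the second moment at `x`, which inherits the decay `(1 + ‖x‖)^{-m}` from `p`; its root is
integrable because `m / 2 > d`. -/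

theorem inner_isometry_add {U : ℕ → F →ₗᵢ[ℂ] H} {T : F →L[ℂ] F}
    (hU : ∀ j n, j ≤ n → ∀ f g, inner ℂ (U j f) (U (n + 1) g) = inner ℂ (U j f) (U n (T g)))
    (j n : ℕ) (f g : F) : inner ℂ (U j f) (U (j + n) g) = inner ℂ f ((T ^ n) g) := by
  induction n generalizing g with
  | zero => simp
  | succ n ih =>
    rw [← add_assoc, hU j (j + n) (Nat.le_add_right _ _), ih, pow_succ]
    rfl

/-- The geometric sum telescopes against `R` to `T R - T^(n+1) R`, and powers of a contraction are
contractions, so the bound is uniform in `n`. -/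
theorem norm_sum_pow_succ_apply_le {T R : F →L[ℂ] F} (hT : ‖T‖ ≤ 1) (hR : (1 - T) * R = 1)
    (n : ℕ) (f : F) : ‖∑ i ∈ Finset.range n, (T ^ (i + 1)) f‖ ≤ 2 * ‖R‖ * ‖f‖ := by
  have hpow : ∀ k : ℕ, ∀ x : F, ‖(T ^ k) x‖ ≤ ‖x‖ := by
    intro k
    induction k with
    | zero => intro x; simp
    | succ k ih =>
      intro x
      rw [pow_succ]
      calc ‖(T ^ k) (T x)‖ ≤ ‖T x‖ := ih _
        _ ≤ ‖T‖ * ‖x‖ := T.le_opNorm x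
        _ ≤ 1 * ‖x‖ := by gcongr
        _ = ‖x‖ := one_mul _
  have h1 : ∑ i ∈ Finset.range n, T ^ (i + 1) = T * R - T ^ (n + 1) * R := by
    have h2 : (∑ i ∈ Finset.range n, T ^ i) = (1 - T ^ n) * R := by
      rw [← geom_sum_mul_neg, mul_assoc, hR, mul_one]
    simp only [pow_succ', ← Finset.mul_sum, h2]
    noncomm_ring
  have h3 : ∑ i ∈ Finset.range n, (T ^ (i + 1)) f = (T ^ 1) (R f) - (T ^ (n + 1)) (R f) := by
    rw [← sum_apply, h1, pow_one]
    rfl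
  rw [h3]
  calc ‖(T ^ 1) (R f) - (T ^ (n + 1)) (R f)‖ ≤ ‖(T ^ 1) (R f)‖ + ‖(T ^ (n + 1)) (R f)‖ :=
        norm_sub_le _ _
    _ ≤ ‖R f‖ + ‖R f‖ := add_le_add (hpow _ _) (hpow _ _)
    _ ≤ ‖R‖ * ‖f‖ + ‖R‖ * ‖f‖ := add_le_add (R.le_opNorm f) (R.le_opNorm f)
    _ = 2 * ‖R‖ * ‖f‖ := by ring

/-- Induction on `N`: a new term adds its own `‖f‖²` and twice a cross term. The cross term pairs
`f` with a geometric sum, hence is at most `2‖R‖‖f‖²`. -/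
theorem norm_sum_isometry_sq_le {U : ℕ → F →ₗᵢ[ℂ] H} {T R : F →L[ℂ] F}
    (hU : ∀ j n, j ≤ n → ∀ f g, inner ℂ (U j f) (U (n + 1) g) = inner ℂ (U j f) (U n (T g)))
    (hT : ‖T‖ ≤ 1) (hR : (1 - T) * R = 1) (N : ℕ) (f : F) :
    ‖∑ k ∈ Finset.range N, U k f‖ ^ 2 ≤ (1 + 4 * ‖R‖) * N * ‖f‖ ^ 2 := by
  induction N with
  | zero => simp
  | succ N ih =>
    have h1 : inner ℂ (∑ k ∈ Finset.range N, U k f) (U N f)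
        = inner ℂ f (∑ i ∈ Finset.range N, (T ^ (i + 1)) f) := by
      -- Reversing the order indexes the terms by lag: time `N - 1 - i` lies `i + 1` before time
      -- `N`.
      rw [sum_inner, inner_sum, ← Finset.sum_range_reflect]
      refine Finset.sum_congr rfl fun i hi => ?_
      have hi' := Finset.mem_range.1 hi
      have h := inner_isometry_add hU (N - 1 - i) (i + 1) f f
      rwa [show N - 1 - i + (i + 1) = N by omega] at h
    have h2 : RCLike.re (inner ℂ (∑ k ∈ Finset.range N, U k f) (U N f)) ≤ 2 * ‖R‖ * ‖f‖ ^ 2 := by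
      rw [h1]
      calc _ ≤ ‖f‖ * ‖∑ i ∈ Finset.range N, (T ^ (i + 1)) f‖ := re_inner_le_norm _ _
        _ ≤ ‖f‖ * (2 * ‖R‖ * ‖f‖) := by
          gcongr
          exact norm_sum_pow_succ_apply_le hT hR N f
        _ = 2 * ‖R‖ * ‖f‖ ^ 2 := by ring
    rw [Finset.sum_range_succ, norm_add_sq (𝕜 := ℂ), LinearIsometry.norm_map]
    push_cast
    linarith

end Hilbert

/-! ### Spectral gaps and invertibility -/

/-- The positive element `star b * b` attains its norm `‖b‖²` at a spectral point, which is real and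
nonnegative, so bounding real parts bounds the norm. -/
theorem CStarAlgebra.norm_lt_one_of_re_spectrum_lt_one {A : Type*} [CStarAlgebra A] {b : A}
    (h : ∀ z ∈ spectrum ℂ (star b * b), z.re < 1) : ‖b‖ < 1 := by
  cases subsingleton_or_nontrivial A with
  | inl hA => simp [Subsingleton.elim b 0]
  | inr hA =>
    have hsa : IsSelfAdjoint (star b * b) := IsSelfAdjoint.star_mul_self b
    obtain ⟨z, hz, hzr⟩ := spectrum.exists_nnnorm_eq_spectralRadius (star b * b)
    rw [hsa.spectralRadius_eq_nnnorm, ENNReal.coe_inj] at hzr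
    have hre : z = (z.re : ℂ) := hsa.mem_spectrum_eq_re hz
    have hz0 : 0 ≤ z.re := by
      refine spectrum_star_mul_self_nonneg (b := b) z.re ?_
      rw [← spectrum.algebraMap_mem_iff (S := ℂ)]
      rw [hre] at hz
      exact hz
    have hn : ‖z‖ = ‖star b * b‖ := congrArg NNReal.toReal hzr
    have hn' : ‖z‖ = z.re := by
      rw [hre, Complex.norm_real, Real.norm_eq_abs, abs_of_nonneg hz0, Complex.ofReal_re]
    rw [CStarRing.norm_star_mul_self, hn'] at hn
    have := h z hz
    nlinarith [norm_nonneg b]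

section Operator

variable {F : Type*} [NormedAddCommGroup F] [InnerProductSpace ℂ F] [CompleteSpace F]

theorem re_lt_one_of_sSup_re_spectrum_lt_one {A : F →L[ℂ] F}
    (h : sSup (Complex.re '' spectrum ℂ A) < 1) {z : ℂ} (hz : z ∈ spectrum ℂ A) : z.re < 1 :=
  -- Compactness of the spectrum makes `sSup` an actual upper bound rather than a default value.
  (le_csSup ((spectrum.isCompact A).image Complex.continuous_re).bddAbove
    (Set.mem_image_of_mem _ hz)).trans_lt h

theorem isUnit_one_sub_of_sSup_re_spectrum_lt_one {A : F →L[ℂ] F}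
    (h : sSup (Complex.re '' spectrum ℂ A) < 1) : IsUnit (1 - A) := by
  by_contra hu
  have h1 : (1 : ℂ) ∈ spectrum ℂ A := by
    rwa [spectrum.mem_iff, map_one]
  exact absurd (re_lt_one_of_sSup_re_spectrum_lt_one h h1) (by simp)

theorem isUnit_one_sub_of_sSup_re_spectrum_adjoint_pow_mul_pow_lt_one {A : F →L[ℂ] F} {k : ℕ}
    (h : sSup (Complex.re '' spectrum ℂ (ContinuousLinearMap.adjoint A ^ k * A ^ k)) < 1) :
    IsUnit (1 - A) := by
  have hn : ‖A ^ k‖ < 1 := by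
    refine CStarAlgebra.norm_lt_one_of_re_spectrum_lt_one (A := F →L[ℂ] F) fun z hz => ?_
    rw [star_pow] at hz
    exact re_lt_one_of_sSup_re_spectrum_lt_one h hz
  have hu := isUnit_one_sub_of_norm_lt_one (R := F →L[ℂ] F) hn
  -- `1 - A^k` is the product of `1 - A` and a geometric sum; the factors commute, so both are
  -- units.
  rw [← mul_neg_geom_sum] at hu
  refine ((Commute.isUnit_mul_iff ?_).1 hu).1
  rw [commute_iff_eq, mul_neg_geom_sum, geom_sum_mul_neg]

end Operator

section Gap

variable {E : Type*} [MeasurableSpace E] {P : Measure E} [IsProbabilityMeasure P]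

theorem isUnit_one_sub_markovOpZero {T : Kernel E E} [IsMarkovKernel T] (hT : T.Invariant P)
    (h : 0 < spectralGap T P hT ∨ 0 < pseudoSpectralGap T P hT) :
    IsUnit (1 - markovOpZero T P hT) := by
  rcases h with h | h
  · rw [spectralGap, operatorGap] at h
    exact isUnit_one_sub_of_sSup_re_spectrum_lt_one (sub_pos.1 h)
  · obtain ⟨k, hk⟩ : ∃ k : ℕ+, 0 < operatorGap
        ((ContinuousLinearMap.adjoint (markovOpZero T P hT)) ^ (k : ℕ)
          * (markovOpZero T P hT) ^ (k : ℕ)) / (k : ℝ) := by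
      -- If every term were nonpositive, so would be the real `⨆`, whose default value for an
      -- unbounded family is 0.
      by_contra! hk
      exact absurd (Real.iSup_nonpos hk) (not_le.2 h)
    have hk' := (div_pos_iff_of_pos_right (by positivity)).1 hk
    rw [operatorGap] at hk'
    exact isUnit_one_sub_of_sSup_re_spectrum_adjoint_pow_mul_pow_lt_one (sub_pos.1 hk')

theorem norm_markovOpZero_le {T : Kernel E E} [IsMarkovKernel T] (hT : T.Invariant P) :
    ‖markovOpZero T P hT‖ ≤ 1 := by
  refine ContinuousLinearMap.opNorm_le_bound _ zero_le_one fun f => ?_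
  calc ‖markovOpZero T P hT f‖ = ‖markovOp T P hT f‖ := rfl
    _ ≤ ‖markovOp T P hT‖ * ‖(f : Lp ℂ 2 P)‖ := ContinuousLinearMap.le_opNorm _ _
    _ ≤ 1 * ‖f‖ := by
      gcongr
      · exact LinearMap.mkContinuous_norm_le _ zero_le_one _
      · rfl

end Gap

/-! ### Correlations of the sample -/

section Chain

variable {E Ω : Type*} [MeasurableSpace E] [MeasurableSpace Ω] {μ : Measure Ω}
  {P : Measure E} {Z : ℕ → Ω → E}

/-- It suffices to compare rectangles `s ×ˢ B`. The event that `(Z j, Z n)` lies in `s` belongs to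
the past up to `n`, so the conditional probability may be integrated over it. -/
theorem IsMarkovChain.map_prodMk_succ [IsProbabilityMeasure μ] {T : Kernel E E} [IsMarkovKernel T]
    (hZ : IsMarkovChain T Z μ) {j n : ℕ} (hj : j ≤ n) :
    μ.map (fun ω => ((Z j ω, Z n ω), Z (n + 1) ω))
      = (μ.map fun ω => (Z j ω, Z n ω)).compProd (T.comap Prod.snd measurable_snd) := by
  have hX : Measurable fun ω => (Z j ω, Z n ω) := (hZ.measurable j).prodMk (hZ.measurable n)
  refine Measure.ext_prod fun {s B} hs hB => ?_
  have hle : (⨆ i ≤ n, MeasurableSpace.comap (Z i) inferInstance) ≤ ‹MeasurableSpace Ω› :=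
    iSup₂_le fun i _ => (hZ.measurable i).comap_le
  have hZm : ∀ i ≤ n, Measurable[⨆ i ≤ n, MeasurableSpace.comap (Z i) inferInstance] (Z i) :=
    fun i hi => (comap_measurable (Z i)).mono
      (le_iSup₂ (f := fun i (_ : i ≤ n) => MeasurableSpace.comap (Z i) inferInstance) i hi) le_rfl
  have hXm : MeasurableSet[⨆ i ≤ n, MeasurableSpace.comap (Z i) inferInstance]
      ((fun ω => (Z j ω, Z n ω)) ⁻¹' s) :=
    ((hZm j hj).prodMk (hZm n le_rfl)) hs
  have hBm : MeasurableSet (Z (n + 1) ⁻¹' B) := hZ.measurable (n + 1) hB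
  have h1 := setIntegral_condExp (μ := μ) hle (f := (Z (n + 1) ⁻¹' B).indicator fun _ => (1 : ℝ))
    ((integrable_const (1 : ℝ)).indicator hBm) hXm
  rw [setIntegral_congr_ae (g := fun ω => (T (Z n ω)).real B) (hle _ hXm)
    ((hZ.markov n B hB).mono fun ω h _ => h)] at h1
  rw [Measure.map_apply (hX.prodMk (hZ.measurable _)) (hs.prod hB),
    Measure.compProd_apply_prod hs hB,
    setLIntegral_map hs (Kernel.measurable_coe _ hB) hX]
  have h2 : ∫⁻ ω in (fun ω => (Z j ω, Z n ω)) ⁻¹' s, T (Z n ω) B ∂μ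
      = ENNReal.ofReal (∫ ω in (fun ω => (Z j ω, Z n ω)) ⁻¹' s, (T (Z n ω)).real B ∂μ) := by
    have hTm : Measurable fun ω => (T (Z n ω)).real B :=
      ((Kernel.measurable_coe T hB).comp (hZ.measurable n)).ennreal_toReal
    rw [ofReal_integral_eq_lintegral_ofReal]
    · simp
    · refine Integrable.of_bound hTm.aestronglyMeasurable 1 (ae_of_all _ fun ω => ?_)
      rw [Real.norm_eq_abs, abs_of_nonneg measureReal_nonneg]
      exact measureReal_le_one
    · exact ae_of_all _ fun ω => measureReal_nonneg
  simp only [Kernel.comap_apply]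
  rw [h2, h1, setIntegral_indicator hBm]
  simp [Set.mk_preimage_prod, measureReal_def, Set.inter_comm]

theorem IsMarkovChain.map_eq [IsProbabilityMeasure μ] {T : Kernel E E} [IsMarkovKernel T] (hT : T.Invariant P)
    (hZ : IsMarkovChain T Z μ) (h0 : μ.map (Z 0) = P) (n : ℕ) : μ.map (Z n) = P := by
  induction n with
  | zero => exact h0
  | succ n ih =>
    have h := congrArg Measure.snd (hZ.map_prodMk_succ (le_refl n))
    rw [Measure.snd_map_prodMk ((hZ.measurable n).prodMk (hZ.measurable n)),
      Measure.snd_compProd] at h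
    rw [h]
    ext s hs
    rw [Measure.bind_apply hs (Kernel.aemeasurable _),
      lintegral_map (Kernel.measurable_coe _ hs) ((hZ.measurable n).prodMk (hZ.measurable n))]
    simp only [Kernel.comap_apply]
    rw [← lintegral_map (f := fun x => T x s) (Kernel.measurable_coe _ hs) (hZ.measurable n), ih,
      ← Measure.bind_apply hs T.aemeasurable, hT.def]

variable [IsProbabilityMeasure P]

/-- Composition with `Z k` as an isometry from `L²₀(P)` to `L²(μ)`. -/
noncomputable def sampleIsometry (hm : ∀ n, Measurable (Z n)) (hP : ∀ n, μ.map (Z n) = P) (k : ℕ) :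
    L2Zero P →ₗᵢ[ℂ] Lp ℂ 2 μ :=
  (Lp.compMeasurePreservingₗᵢ ℂ (Z k) ⟨hm k, hP k⟩).comp (L2Zero P).subtypeₗᵢ

theorem sampleIsometry_ae (hm : ∀ n, Measurable (Z n)) (hP : ∀ n, μ.map (Z n) = P) (k : ℕ)
    (f : L2Zero P) : sampleIsometry hm hP k f =ᵐ[μ] fun ω => (f : Lp ℂ 2 P) (Z k ω) :=
  Lp.coeFn_compMeasurePreserving (f : Lp ℂ 2 P) ⟨hm k, hP k⟩

theorem inner_sampleIsometry (hm : ∀ n, Measurable (Z n)) (hP : ∀ n, μ.map (Z n) = P) (j k : ℕ)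
    (f g : L2Zero P) : inner ℂ (sampleIsometry hm hP j f) (sampleIsometry hm hP k g)
      = ∫ ω, (starRingEnd ℂ) ((f : Lp ℂ 2 P) (Z j ω)) * (g : Lp ℂ 2 P) (Z k ω) ∂μ := by
  rw [L2.inner_def]
  refine integral_congr_ae ?_
  filter_upwards [sampleIsometry_ae hm hP j f, sampleIsometry_ae hm hP k g] with ω h1 h2
  rw [h1, h2, RCLike.inner_apply, mul_comm]

/-- Integrating out `Z (n + 1)` given `(Z j, Z n)` leaves the factor `f(Z j)` alone and replaces
`g(Z (n + 1))` by `(T g)(Z n)`. -/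
theorem IsMarkovChain.inner_sampleIsometry_succ [IsProbabilityMeasure μ] {T : Kernel E E} [IsMarkovKernel T]
    (hT : T.Invariant P) (hZ : IsMarkovChain T Z μ) (hP : ∀ n, μ.map (Z n) = P) {j n : ℕ}
    (hj : j ≤ n) (f g : L2Zero P) :
    inner ℂ (sampleIsometry hZ.measurable hP j f) (sampleIsometry hZ.measurable hP (n + 1) g)
      = inner ℂ (sampleIsometry hZ.measurable hP j f)
          (sampleIsometry hZ.measurable hP n (markovOpZero T P hT g)) := by
  rw [inner_sampleIsometry, inner_sampleIsometry]
  have hX : Measurable fun ω => (Z j ω, Z n ω) := (hZ.measurable j).prodMk (hZ.measurable n)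
  have hfm := (Lp.stronglyMeasurable (f : Lp ℂ 2 P))
  have hgm := (Lp.stronglyMeasurable (g : Lp ℂ 2 P))
  set G : (E × E) × E → ℂ :=
    fun q => (starRingEnd ℂ) ((f : Lp ℂ 2 P) q.1.1) * (g : Lp ℂ 2 P) q.2 with hG
  have hGm : StronglyMeasurable G := by
    refine StronglyMeasurable.mul ?_ (hgm.comp_measurable measurable_snd)
    exact RCLike.continuous_conj.comp_stronglyMeasurable
      (hfm.comp_measurable (measurable_fst.comp measurable_fst))
  have hXZ := hX.prodMk (hZ.measurable (n + 1))
  have hL2 : ∀ (u : Lp ℂ 2 P) (k : ℕ), MemLp (fun ω => u (Z k ω)) 2 μ := fun u k =>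
    (Lp.memLp u).comp_measurePreserving ⟨hZ.measurable k, hP k⟩
  have hint : Integrable G (μ.map fun ω => ((Z j ω, Z n ω), Z (n + 1) ω)) := by
    rw [integrable_map_measure hGm.aestronglyMeasurable hXZ.aemeasurable]
    exact ((hL2 f j).star).integrable_mul (hL2 g (n + 1))
  have h1 : ∫ ω, (starRingEnd ℂ) ((f : Lp ℂ 2 P) (Z j ω)) * (g : Lp ℂ 2 P) (Z (n + 1) ω) ∂μ
      = ∫ q, G q ∂(μ.map fun ω => ((Z j ω, Z n ω), Z (n + 1) ω)) :=
    (integral_map hXZ.aemeasurable hGm.aestronglyMeasurable).symm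
  rw [h1]
  rw [hZ.map_prodMk_succ hj] at hint ⊢
  rw [Measure.integral_compProd hint, integral_map hX.aemeasurable]
  · refine integral_congr_ae ?_
    -- `T g` is given by the kernel integral only `P`-almost everywhere; this transfers to `μ`
    -- because `Z n` has law `P`.
    have h2 : ∀ᵐ ω ∂μ, markovOp T P hT g (Z n ω) = ∫ y, (g : Lp ℂ 2 P) y ∂T (Z n ω) :=
      (MeasurePreserving.quasiMeasurePreserving ⟨hZ.measurable n, hP n⟩).ae (markovOp_ae hT g)
    filter_upwards [h2] with ω h
    simp only [Kernel.comap_apply, hG]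
    rw [integral_const_mul, ← h]
    rfl
  · exact (hGm.integral_kernel_prod_right' (κ := T.comap Prod.snd measurable_snd)).aestronglyMeasurable

theorem IsIIDSample.inner_sampleIsometry_eq_zero (hZ : IsIIDSample Z P μ) {j k : ℕ} (hj : j ≠ k)
    (f g : L2Zero P) :
    inner ℂ (sampleIsometry hZ.1 hZ.2.1 j f) (sampleIsometry hZ.1 hZ.2.1 k g) = 0 := by
  rw [inner_sampleIsometry]
  have hfm := (Lp.stronglyMeasurable (f : Lp ℂ 2 P))
  have hgm := (Lp.stronglyMeasurable (g : Lp ℂ 2 P))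
  have hfm' := RCLike.continuous_conj.comp_stronglyMeasurable hfm
  have hi := (hZ.2.2.indepFun hj).comp hfm'.measurable hgm.measurable
  have h := hi.integral_fun_mul_eq_mul_integral
    (hfm'.comp_measurable (hZ.1 j)).aestronglyMeasurable
    (hgm.comp_measurable (hZ.1 k)).aestronglyMeasurable
  have h0 : ∫ ω, (g : Lp ℂ 2 P) (Z k ω) ∂μ = 0 := by
    rw [← integral_map (hZ.1 k).aemeasurable hgm.aestronglyMeasurable, hZ.2.1 k]
    exact (mem_L2Zero_iff _).1 g.2
  simp only [Function.comp_apply] at h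
  rw [h, h0, mul_zero]

/-- The sum of a centred function along the sample has variance at most linear in the length. -/
theorem exists_norm_sum_sampleIsometry_sq_le [IsProbabilityMeasure μ]
    (hZ : IsIIDSample Z P μ ∨ IsStationaryChainWithGap Z P μ) :
    ∃ (hm : ∀ n, Measurable (Z n)) (hP : ∀ n, μ.map (Z n) = P) (C : ℝ), 0 < C ∧
      ∀ (N : ℕ) (f : L2Zero P),
        ‖∑ k ∈ Finset.range N, sampleIsometry hm hP k f‖ ^ 2 ≤ C * N * ‖f‖ ^ 2 := by
  rcases hZ with hZ | ⟨T, hTm, hT, hZ, h0, hgap⟩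
  -- The constant `1 + 4‖R‖` for `T = 0` and `R = 1`.
  · refine ⟨hZ.1, hZ.2.1, 1 + 4 * ‖(1 : L2Zero P →L[ℂ] L2Zero P)‖, by positivity, fun N f => ?_⟩
    have h0 : ∀ j n, j ≤ n → ∀ f g : L2Zero P,
        inner ℂ (sampleIsometry hZ.1 hZ.2.1 j f) (sampleIsometry hZ.1 hZ.2.1 (n + 1) g)
          = inner ℂ (sampleIsometry hZ.1 hZ.2.1 j f)
            (sampleIsometry hZ.1 hZ.2.1 n ((0 : L2Zero P →L[ℂ] L2Zero P) g)) := by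
      intro j n hj f g
      rw [hZ.inner_sampleIsometry_eq_zero (by omega), zero_apply, map_zero, inner_zero_right]
    exact norm_sum_isometry_sq_le h0 (ContinuousLinearMap.opNorm_zero.trans_le zero_le_one)
      (by rw [sub_zero, one_mul]) N f
  · have hP := hZ.map_eq hT h0
    obtain ⟨R, hR⟩ := (isUnit_one_sub_markovOpZero hT hgap).exists_right_inv
    exact ⟨hZ.measurable, hP, 1 + 4 * ‖R‖, by positivity, fun N f =>
      norm_sum_isometry_sq_le (fun j n hj f g => hZ.inner_sampleIsometry_succ hT hP hj f g)
        (norm_markovOpZero_le hT) hR N f⟩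

end Chain

/-! ### Variance of empirical means -/

section EmpiricalMean

theorem MeasureTheory.MemLp.lintegral_enorm_sq {α G : Type*} [MeasurableSpace α]
    [NormedAddCommGroup G] {ν : Measure α} {f : α → G} (hf : MemLp f 2 ν) :
    ∫⁻ x, ‖f x‖ₑ ^ 2 ∂ν = ENNReal.ofReal ((eLpNorm f 2 ν).toReal ^ 2) := by
  rw [ENNReal.ofReal_pow ENNReal.toReal_nonneg, ENNReal.ofReal_toReal hf.2.ne,
    eLpNorm_eq_lintegral_rpow_enorm_toReal (by norm_num) (by norm_num), ← ENNReal.rpow_natCast,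
    ← ENNReal.rpow_mul]
  norm_num

theorem Real.enorm_sq_eq_ofReal (a : ℝ) : ‖a‖ₑ ^ 2 = ENNReal.ofReal (a ^ 2) := by
  rw [Real.enorm_eq_ofReal_abs, ← ENNReal.ofReal_pow (abs_nonneg a), sq_abs]

theorem Complex.enorm_ofReal_sq (a : ℝ) : ‖(a : ℂ)‖ₑ ^ 2 = ENNReal.ofReal (a ^ 2) := by
  rw [← Real.enorm_sq_eq_ofReal, ← ofReal_norm, ← ofReal_norm, Complex.norm_real]

theorem lintegral_ofReal_le_sqrt {α : Type*} [MeasurableSpace α] {ν : Measure α}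
    [IsProbabilityMeasure ν] {f : α → ℝ} (hf : AEMeasurable f ν) :
    ∫⁻ x, ENNReal.ofReal |f x| ∂ν ≤ (∫⁻ x, ENNReal.ofReal (f x ^ 2) ∂ν) ^ (1 / 2 : ℝ) := by
  have h := eLpNorm_le_eLpNorm_of_exponent_le (p := 1) (q := 2) (by norm_num)
    hf.aestronglyMeasurable
  rw [eLpNorm_one_eq_lintegral_enorm,
    eLpNorm_eq_lintegral_rpow_enorm_toReal (by norm_num) (by norm_num)] at h
  simpa [← Real.enorm_eq_ofReal_abs, ← Real.enorm_sq_eq_ofReal] using h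

variable {E Ω : Type*} [MeasurableSpace E] [MeasurableSpace Ω] {μ : Measure Ω}
  {P : Measure E} [IsProbabilityMeasure P] {Z : ℕ → Ω → E}

theorem lintegral_sq_empiricalMean_sub_le (hm : ∀ n, Measurable (Z n))
    (hP : ∀ n, μ.map (Z n) = P) {C : ℝ} (hC : 0 < C)
    (hb : ∀ (N : ℕ) (f : L2Zero P),
      ‖∑ k ∈ Finset.range N, sampleIsometry hm hP k f‖ ^ 2 ≤ C * N * ‖f‖ ^ 2)
    {g : E → ℝ} (hg : AEMeasurable g P) {N : ℕ} (hN : 1 ≤ N) :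
    ∫⁻ ω, ENNReal.ofReal ((1 / (N : ℝ) * ∑ k ∈ Finset.range N, g (Z k ω) - ∫ z, g z ∂P) ^ 2) ∂μ
      ≤ ENNReal.ofReal (C / N) * ∫⁻ z, ENNReal.ofReal (g z ^ 2) ∂P := by
  have hN0 : (0 : ℝ) < N := by exact_mod_cast hN
  -- With an infinite second moment the right-hand side is `∞`, since `C / N > 0`.
  by_cases hfin : ∫⁻ z, ENNReal.ofReal (g z ^ 2) ∂P = ∞
  · rw [hfin, ENNReal.mul_top]
    · exact le_top
    · exact (ENNReal.ofReal_pos.2 (by positivity)).ne'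
  have hsq : Integrable (fun z => g z ^ 2) P := by
    refine ⟨(hg.pow_const 2).aestronglyMeasurable, ?_⟩
    rw [hasFiniteIntegral_iff_ofReal (ae_of_all _ fun z => sq_nonneg _)]
    exact lt_top_iff_ne_top.2 hfin
  have hgL : MemLp g 2 P := (memLp_two_iff_integrable_sq hg.aestronglyMeasurable).2 hsq
  set c := ∫ z, g z ∂P with hc
  have hgc : MemLp (fun z => g z - c) 2 P := hgL.sub (memLp_const c)
  have hfL : MemLp (fun z => ((g z - c : ℝ) : ℂ)) 2 P := hgc.ofReal
  have hmem : hfL.toLp _ ∈ L2Zero P := by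
    rw [mem_L2Zero_iff, integral_congr_ae hfL.coeFn_toLp, integral_complex_ofReal,
      integral_sub (hgL.integrable (by norm_num)) (integrable_const c)]
    simp [hc]
  set F : L2Zero P := ⟨hfL.toLp _, hmem⟩ with hF
  -- Centring does not increase the second moment.
  have hFn : ENNReal.ofReal (‖F‖ ^ 2) ≤ ∫⁻ z, ENNReal.ofReal (g z ^ 2) ∂P := by
    have h1 : ENNReal.ofReal (‖F‖ ^ 2) = ∫⁻ z, ENNReal.ofReal ((g z - c) ^ 2) ∂P := by
      have : ‖F‖ = (eLpNorm (fun z => ((g z - c : ℝ) : ℂ)) 2 P).toReal := Lp.norm_toLp _ hfL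
      rw [this, ← hfL.lintegral_enorm_sq]
      exact lintegral_congr fun z => Complex.enorm_ofReal_sq _
    rw [h1, ← ofReal_integral_eq_lintegral_ofReal hgc.integrable_sq
      (ae_of_all _ fun z => sq_nonneg _), ← ofReal_integral_eq_lintegral_ofReal hsq
      (ae_of_all _ fun z => sq_nonneg _)]
    refine ENNReal.ofReal_le_ofReal ?_
    have := variance_le_expectation_sq (μ := P) hg.aestronglyMeasurable
    rwa [variance_eq_integral hg] at this
  have hae : ∀ᵐ ω ∂μ, (∑ k ∈ Finset.range N, sampleIsometry hm hP k F : Lp ℂ 2 μ) ω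
      = ((∑ k ∈ Finset.range N, (g (Z k ω) - c) : ℝ) : ℂ) := by
    have h1 : ∀ k, ∀ᵐ ω ∂μ, sampleIsometry hm hP k F ω = ((g (Z k ω) - c : ℝ) : ℂ) := fun k => by
      have h2 := (MeasurePreserving.quasiMeasurePreserving ⟨hm k, hP k⟩).ae hfL.coeFn_toLp
      filter_upwards [sampleIsometry_ae hm hP k F, h2] with ω h3 h4
      rw [h3, hF, h4]
    filter_upwards [ae_all_iff.2 h1, Lp.coeFn_finsetSum (Finset.range N)
      fun k => sampleIsometry hm hP k F] with ω h2 h3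
    rw [h3, Finset.sum_apply, Complex.ofReal_sum]
    exact Finset.sum_congr rfl fun k _ => h2 k
  have hS : ∫⁻ ω, ENNReal.ofReal ((∑ k ∈ Finset.range N, (g (Z k ω) - c)) ^ 2) ∂μ
      = ENNReal.ofReal (‖∑ k ∈ Finset.range N, sampleIsometry hm hP k F‖ ^ 2) := by
    rw [Lp.norm_def, ← (Lp.memLp _).lintegral_enorm_sq]
    refine lintegral_congr_ae ?_
    filter_upwards [hae] with ω h
    rw [h, Complex.enorm_ofReal_sq]
  have hmean : ∀ ω, ENNReal.ofReal ((1 / (N : ℝ) * ∑ k ∈ Finset.range N, g (Z k ω) - c) ^ 2)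
      = ENNReal.ofReal ((1 / (N : ℝ)) ^ 2)
        * ENNReal.ofReal ((∑ k ∈ Finset.range N, (g (Z k ω) - c)) ^ 2) := fun ω => by
    rw [← ENNReal.ofReal_mul (by positivity), Finset.sum_sub_distrib, Finset.sum_const,
      Finset.card_range, nsmul_eq_mul]
    congr 1
    field_simp
  simp_rw [hmean]
  rw [lintegral_const_mul' _ _ ENNReal.ofReal_ne_top, hS]
  calc _ ≤ ENNReal.ofReal ((1 / (N : ℝ)) ^ 2) * ENNReal.ofReal (C * N * ‖F‖ ^ 2) := by
        gcongr
        exact hb N F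
    _ = ENNReal.ofReal (C / N) * ENNReal.ofReal (‖F‖ ^ 2) := by
      rw [← ENNReal.ofReal_mul (by positivity), ← ENNReal.ofReal_mul (by positivity)]
      congr 1
      field_simp
    _ ≤ _ := by gcongr

end EmpiricalMean

/-! ### Scaled kernels -/

section ScaledKernel

variable {d : ℕ}

theorem lintegral_comp_inv_smul {h : ℝ} (hh : 0 < h) (f : EuclideanSpace ℝ (Fin d) → ℝ≥0∞) :
    ∫⁻ x, f (h⁻¹ • x) = ENNReal.ofReal (h ^ d) * ∫⁻ u, f u := by
  have hne : h⁻¹ ≠ 0 := inv_ne_zero hh.ne'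
  have h1 := lintegral_map_equiv (μ := volume) f
    (Homeomorph.smulOfNeZero (α := EuclideanSpace ℝ (Fin d)) h⁻¹ hne).toMeasurableEquiv
  have h2 : (volume : Measure (EuclideanSpace ℝ (Fin d))).map
      (Homeomorph.smulOfNeZero (α := EuclideanSpace ℝ (Fin d)) h⁻¹ hne).toMeasurableEquiv
      = ENNReal.ofReal (h ^ d) • volume := by
    have := Measure.map_addHaar_smul (volume : Measure (EuclideanSpace ℝ (Fin d))) hne
    rw [finrank_euclideanSpace_fin, inv_pow, inv_inv, abs_of_pos (by positivity)] at this
    exact this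
  rw [h2, lintegral_smul_measure, smul_eq_mul] at h1
  exact h1.symm

/-- Lets almost everywhere statements about `K` pass to `K_h(x, ·)`. -/
theorem quasiMeasurePreserving_inv_smul_sub {h : ℝ} (hh : 0 < h) (x : EuclideanSpace ℝ (Fin d)) :
    Measure.QuasiMeasurePreserving (fun z => h⁻¹ • (x - z))
      (volume : Measure (EuclideanSpace ℝ (Fin d))) volume := by
  refine Measure.QuasiMeasurePreserving.comp (μb := volume) (g := fun u => h⁻¹ • u) ?_
    (Measure.measurePreserving_sub_left volume x).quasiMeasurePreserving
  refine ⟨measurable_const_smul _, ?_⟩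
  rw [Measure.map_addHaar_smul _ (inv_ne_zero hh.ne')]
  exact Measure.smul_absolutelyContinuous

theorem aemeasurable_scaledKernel {K : EuclideanSpace ℝ (Fin d) → ℝ} (hK : AEMeasurable K volume)
    {h : ℝ} (hh : 0 < h) (x : EuclideanSpace ℝ (Fin d)) :
    AEMeasurable (scaledKernel K h x) volume :=
  (hK.comp_quasiMeasurePreserving (quasiMeasurePreserving_inv_smul_sub hh x)).const_mul _

theorem scaledKernel_ae_congr {K K' : EuclideanSpace ℝ (Fin d) → ℝ} (hK : K =ᵐ[volume] K')
    {h : ℝ} (hh : 0 < h) (x : EuclideanSpace ℝ (Fin d)) :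
    scaledKernel K h x =ᵐ[volume] scaledKernel K' h x := by
  filter_upwards [(quasiMeasurePreserving_inv_smul_sub hh x).ae hK] with z hz
  rw [scaledKernel, scaledKernel, hz]

theorem lintegral_lintegral_scaledKernel_sq {P : Measure (EuclideanSpace ℝ (Fin d))}
    [IsProbabilityMeasure P] (hP : P ≪ volume) {K : EuclideanSpace ℝ (Fin d) → ℝ}
    (hK : AEMeasurable K volume) {h : ℝ} (hh : 0 < h) :
    ∫⁻ x, ∫⁻ z, ENNReal.ofReal (scaledKernel K h x z ^ 2) ∂P
      = ENNReal.ofReal (1 / h ^ d) * ∫⁻ u, ENNReal.ofReal (K u ^ 2) := by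
  -- A measurable version of `K` makes the integrand jointly measurable, as Tonelli requires.
  have h1 : ∀ x, ∫⁻ z, ENNReal.ofReal (scaledKernel K h x z ^ 2) ∂P
      = ∫⁻ z, ENNReal.ofReal (scaledKernel (hK.mk K) h x z ^ 2) ∂P := fun x => by
    refine lintegral_congr_ae ?_
    filter_upwards [hP.ae_le (scaledKernel_ae_congr hK.ae_eq_mk hh x)] with z hz
    rw [hz]
  have h2 : ∫⁻ u, ENNReal.ofReal (K u ^ 2) = ∫⁻ u, ENNReal.ofReal (hK.mk K u ^ 2) := by
    refine lintegral_congr_ae ?_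
    filter_upwards [hK.ae_eq_mk] with z hz
    rw [hz]
  have hmeas : Measurable fun q : EuclideanSpace ℝ (Fin d) × EuclideanSpace ℝ (Fin d) =>
      ENNReal.ofReal (scaledKernel (hK.mk K) h q.1 q.2 ^ 2) := by
    refine ENNReal.measurable_ofReal.comp (Measurable.pow_const (Measurable.const_mul ?_ _) _)
    exact hK.measurable_mk.comp (by fun_prop)
  simp_rw [h1]
  rw [lintegral_lintegral_swap hmeas.aemeasurable, h2]
  have h3 : ∀ z, ∫⁻ x, ENNReal.ofReal (scaledKernel (hK.mk K) h x z ^ 2)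
      = ENNReal.ofReal (1 / h ^ d) * ∫⁻ u, ENNReal.ofReal (hK.mk K u ^ 2) := fun z => by
    have h4 : ∀ x, ENNReal.ofReal (scaledKernel (hK.mk K) h x z ^ 2)
        = ENNReal.ofReal ((1 / h ^ d) ^ 2) * ENNReal.ofReal (hK.mk K (h⁻¹ • (x - z)) ^ 2) :=
      fun x => by rw [← ENNReal.ofReal_mul (by positivity), scaledKernel, mul_pow]
    simp_rw [h4]
    rw [lintegral_const_mul' _ _ ENNReal.ofReal_ne_top,
      lintegral_sub_right_eq_self (fun x => ENNReal.ofReal (hK.mk K (h⁻¹ • x) ^ 2)) z,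
      lintegral_comp_inv_smul hh fun u => ENNReal.ofReal (hK.mk K u ^ 2), ← mul_assoc,
      ← ENNReal.ofReal_mul (by positivity)]
    congr 2
    field_simp
  simp_rw [h3]
  simp

/-- Since `h < 1`, dividing by `h` only enlarges `x - z`, so `1 + ‖x‖ ≤ (1 + ‖z‖)(1 + ‖(x - z)/h‖)`.
Decay at `z` thus becomes decay at `x`, at the price of a weight that `M_{K,m}` absorbs. -/
theorem rpow_one_add_norm_neg_le {m h : ℝ} (hm : 0 ≤ m) (hh : 0 < h) (hh1 : h < 1)
    (x z : EuclideanSpace ℝ (Fin d)) :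
    (1 + ‖z‖) ^ (-m) ≤ (1 + ‖x‖) ^ (-m) * (1 + ‖h⁻¹ • (x - z)‖) ^ m := by
  have h1 : ‖x - z‖ ≤ ‖h⁻¹ • (x - z)‖ := by
    rw [norm_smul, Real.norm_eq_abs, abs_of_pos (inv_pos.2 hh)]
    exact le_mul_of_one_le_left (norm_nonneg _) (one_le_inv₀ hh |>.2 hh1.le)
  have h2 : 1 + ‖x‖ ≤ (1 + ‖z‖) * (1 + ‖h⁻¹ • (x - z)‖) := by
    have h3 : ‖x‖ ≤ ‖z‖ + ‖x - z‖ := by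
      simpa using norm_add_le z (x - z)
    nlinarith [norm_nonneg z, norm_nonneg (h⁻¹ • (x - z))]
  have h4 : (1 + ‖x‖) ^ m ≤ (1 + ‖z‖) ^ m * (1 + ‖h⁻¹ • (x - z)‖) ^ m := by
    rw [← Real.mul_rpow (by positivity) (by positivity)]
    exact Real.rpow_le_rpow (by positivity) h2 hm
  rw [Real.rpow_neg (by positivity), Real.rpow_neg (by positivity), inv_mul_eq_div,
    le_div_iff₀ (by positivity), inv_mul_le_iff₀ (by positivity)]
  exact h4

theorem lintegral_scaledKernel_sq_le_of_decay {P : Measure (EuclideanSpace ℝ (Fin d))}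
    {p : EuclideanSpace ℝ (Fin d) → ℝ} (hpm : AEMeasurable p volume)
    (hP : P = volume.withDensity fun x => ENNReal.ofReal (p x))
    {K : EuclideanSpace ℝ (Fin d) → ℝ} (hK : AEMeasurable K volume) {h : ℝ} (hh : 0 < h)
    (hh1 : h < 1) {m Cp : ℝ} (hm : 0 ≤ m) (hCp : 0 < Cp)
    (hint : Integrable (fun u : EuclideanSpace ℝ (Fin d) => (1 + ‖u‖) ^ m * K u ^ 2) volume)
    (hp : ∀ᵐ x : EuclideanSpace ℝ (Fin d), p x ≤ Cp * (1 + ‖x‖) ^ (-m))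
    (x : EuclideanSpace ℝ (Fin d)) :
    ∫⁻ z, ENNReal.ofReal (scaledKernel K h x z ^ 2) ∂P
      ≤ ENNReal.ofReal (Cp * (∫ u : EuclideanSpace ℝ (Fin d), (1 + ‖u‖) ^ m * K u ^ 2) / h ^ d
          * (1 + ‖x‖) ^ (-m)) := by
  rw [hP, lintegral_withDensity_eq_lintegral_mul₀ hpm.ennreal_ofReal
    ((aemeasurable_scaledKernel hK hh x).pow_const 2).ennreal_ofReal]
  have hle : ∀ᵐ z : EuclideanSpace ℝ (Fin d),
      ((fun x => ENNReal.ofReal (p x)) * fun z => ENNReal.ofReal (scaledKernel K h x z ^ 2)) z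
        ≤ ENNReal.ofReal (Cp * (1 + ‖x‖) ^ (-m) * (1 / h ^ d) ^ 2)
          * ENNReal.ofReal ((1 + ‖h⁻¹ • (x - z)‖) ^ m * K (h⁻¹ • (x - z)) ^ 2) := by
    filter_upwards [hp] with z hz
    rw [Pi.mul_apply, ← ENNReal.ofReal_mul' (sq_nonneg _), ← ENNReal.ofReal_mul (by positivity)]
    refine ENNReal.ofReal_le_ofReal ?_
    calc p z * scaledKernel K h x z ^ 2
        ≤ Cp * ((1 + ‖x‖) ^ (-m) * (1 + ‖h⁻¹ • (x - z)‖) ^ m) * scaledKernel K h x z ^ 2 := by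
          gcongr
          exact hz.trans (by gcongr; exact rpow_one_add_norm_neg_le hm hh hh1 x z)
      _ = _ := by rw [scaledKernel]; ring
  refine (lintegral_mono_ae hle).trans_eq ?_
  rw [lintegral_const_mul' _ _ ENNReal.ofReal_ne_top,
    lintegral_sub_left_eq_self (fun w : EuclideanSpace ℝ (Fin d) =>
      ENNReal.ofReal ((1 + ‖h⁻¹ • w‖) ^ m * K (h⁻¹ • w) ^ 2)) x,
    lintegral_comp_inv_smul hh fun u => ENNReal.ofReal ((1 + ‖u‖) ^ m * K u ^ 2),
    ← ofReal_integral_eq_lintegral_ofReal hint (ae_of_all _ fun u => by positivity),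
    ← ENNReal.ofReal_mul (by positivity), ← ENNReal.ofReal_mul (by positivity)]
  congr 1
  field_simp

end ScaledKernel

/-! ### The kernel density estimator -/

section Estimator

variable {d : ℕ} {Ω : Type*} [MeasurableSpace Ω] {μ : Measure Ω}
  {P : Measure (EuclideanSpace ℝ (Fin d))}
  {Z : ℕ → Ω → EuclideanSpace ℝ (Fin d)}

/-- `C / N` times the second moment under `P` bounds the mean square error of the empirical mean of
every function over the first `N` sample points. -/
def MeanSquareBound (C : ℝ) (Z : ℕ → Ω → EuclideanSpace ℝ (Fin d))
    (P : Measure (EuclideanSpace ℝ (Fin d))) (μ : Measure Ω) : Prop :=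
  ∀ (g : EuclideanSpace ℝ (Fin d) → ℝ), AEMeasurable g P → ∀ N : ℕ, 1 ≤ N →
    ∫⁻ ω, ENNReal.ofReal ((1 / (N : ℝ) * ∑ k ∈ Finset.range N, g (Z k ω) - ∫ z, g z ∂P) ^ 2) ∂μ
      ≤ ENNReal.ofReal (C / N) * ∫⁻ z, ENNReal.ofReal (g z ^ 2) ∂P

theorem integratedVariance_le [IsProbabilityMeasure P] (hP : P ≪ volume) {C : ℝ} (hC : 0 < C)
    (hb : MeanSquareBound C Z P μ) {K : EuclideanSpace ℝ (Fin d) → ℝ} (hK : MemLp K 2 volume)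
    {h : ℝ} (hh : 0 < h) {N : ℕ} (hN : 1 ≤ N) :
    integratedVariance μ P K h Z N
      ≤ ENNReal.ofReal (C / ((N : ℝ) * h ^ d) * (eLpNorm K 2 volume).toReal ^ 2) := by
  have hN0 : (0 : ℝ) < N := by exact_mod_cast hN
  have hKm := hK.1.aemeasurable
  calc integratedVariance μ P K h Z N
      ≤ ∫⁻ x, ENNReal.ofReal (C / N) * ∫⁻ z, ENNReal.ofReal (scaledKernel K h x z ^ 2) ∂P :=
        lintegral_mono fun x =>
          hb (scaledKernel K h x) ((aemeasurable_scaledKernel hKm hh x).mono_ac hP) N hN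
    _ = ENNReal.ofReal (C / N) * (ENNReal.ofReal (1 / h ^ d)
          * ENNReal.ofReal ((eLpNorm K 2 volume).toReal ^ 2)) := by
      rw [lintegral_const_mul' _ _ ENNReal.ofReal_ne_top,
        lintegral_lintegral_scaledKernel_sq hP hKm hh, ← hK.lintegral_enorm_sq]
      simp_rw [Real.enorm_sq_eq_ofReal]
    _ = _ := by
      rw [← ENNReal.ofReal_mul (by positivity), ← ENNReal.ofReal_mul (by positivity)]
      congr 1
      field_simp

theorem sqrt_div_mul_rpow_neg {C D n h t m : ℝ} (hCD : 0 ≤ C * D) (hn : 0 ≤ n) (hh : 0 ≤ h)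
    (ht : 0 ≤ t) (k : ℕ) :
    √(C / n * (D / h ^ k * t ^ (-m))) = √(C * D) / (√n * h ^ ((k : ℝ) / 2)) * t ^ (-m / 2) := by
  have h1 : √(t ^ (-m)) = t ^ (-m / 2) := by
    rw [Real.sqrt_eq_rpow, ← Real.rpow_mul ht, mul_one_div]
  have h2 : √(h ^ k) = h ^ ((k : ℝ) / 2) := by
    rw [Real.sqrt_eq_rpow, ← Real.rpow_natCast, ← Real.rpow_mul hh, mul_one_div]
  rw [show C / n * (D / h ^ k * t ^ (-m)) = C * D / (n * h ^ k) * t ^ (-m) by ring,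
    Real.sqrt_mul (div_nonneg hCD (by positivity)), Real.sqrt_div hCD, Real.sqrt_mul hn, h1, h2]

theorem integratedMAD_le [IsProbabilityMeasure μ] (hZm : ∀ n, Measurable (Z n))
    (hZP : ∀ n, μ.map (Z n) = P) {p : EuclideanSpace ℝ (Fin d) → ℝ} (hpm : AEMeasurable p volume)
    (hP : P = volume.withDensity fun x => ENNReal.ofReal (p x)) {C : ℝ} (hC : 0 < C)
    (hb : MeanSquareBound C Z P μ) {K : EuclideanSpace ℝ (Fin d) → ℝ}
    (hK : AEMeasurable K volume) {h : ℝ} (hh : 0 < h) (hh1 : h < 1) {m Cp : ℝ} (hm : 0 ≤ m)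
    (hCp : 0 < Cp)
    (hint : Integrable (fun u : EuclideanSpace ℝ (Fin d) => (1 + ‖u‖) ^ m * K u ^ 2) volume)
    (hp : ∀ᵐ x : EuclideanSpace ℝ (Fin d), p x ≤ Cp * (1 + ‖x‖) ^ (-m))
    (hint' : Integrable (fun x : EuclideanSpace ℝ (Fin d) => (1 + ‖x‖) ^ (-m / 2)) volume)
    {N : ℕ} (hN : 1 ≤ N) :
    integratedMAD μ P K h Z N
      ≤ ENNReal.ofReal
          (√(C * Cp * ∫ u : EuclideanSpace ℝ (Fin d), (1 + ‖u‖) ^ m * K u ^ 2)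
              * (∫ x : EuclideanSpace ℝ (Fin d), (1 + ‖x‖) ^ (-m / 2))
            / (√(N : ℝ) * h ^ ((d : ℝ) / 2))) := by
  have hN0 : (0 : ℝ) < N := by exact_mod_cast hN
  set M := ∫ u : EuclideanSpace ℝ (Fin d), (1 + ‖u‖) ^ m * K u ^ 2 with hM
  have hM0 : 0 ≤ M := integral_nonneg fun u => by positivity
  have hac : P ≪ volume := hP ▸ withDensity_absolutelyContinuous _ _
  have hpt : ∀ x : EuclideanSpace ℝ (Fin d),
      ∫⁻ ω, ENNReal.ofReal |kdeDeviation P K h Z N ω x| ∂μ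
        ≤ ENNReal.ofReal (√(C * Cp * M) / (√(N : ℝ) * h ^ ((d : ℝ) / 2))
          * (1 + ‖x‖) ^ (-m / 2)) := fun x => by
    have hKx : AEMeasurable (scaledKernel K h x) P :=
      (aemeasurable_scaledKernel hK hh x).mono_ac hac
    have hdev : AEMeasurable (fun ω => kdeDeviation P K h Z N ω x) μ := by
      refine AEMeasurable.sub_const (AEMeasurable.const_mul ?_ _) _
      refine Finset.aemeasurable_fun_sum _ fun k _ => ?_
      exact hKx.comp_quasiMeasurePreserving
        (MeasurePreserving.quasiMeasurePreserving ⟨hZm k, hZP k⟩)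
    calc _ ≤ (∫⁻ ω, ENNReal.ofReal (kdeDeviation P K h Z N ω x ^ 2) ∂μ) ^ (1 / 2 : ℝ) :=
          lintegral_ofReal_le_sqrt hdev
      _ ≤ (ENNReal.ofReal (C / N) * ENNReal.ofReal (Cp * M / h ^ d * (1 + ‖x‖) ^ (-m)))
            ^ (1 / 2 : ℝ) := by
          gcongr
          refine (hb _ hKx N hN).trans ?_
          gcongr
          exact lintegral_scaledKernel_sq_le_of_decay hpm hP hK hh hh1 hm hCp hint hp x
      _ = ENNReal.ofReal (√(C / N * (Cp * M / h ^ d * (1 + ‖x‖) ^ (-m)))) := by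
          rw [← ENNReal.ofReal_mul (by positivity),
            ENNReal.ofReal_rpow_of_nonneg (by positivity) (by norm_num), Real.sqrt_eq_rpow]
      _ = _ := by
          rw [sqrt_div_mul_rpow_neg (by positivity) hN0.le hh.le (by positivity),
            ← mul_assoc]
  refine (lintegral_mono hpt).trans_eq ?_
  rw [← ofReal_integral_eq_lintegral_ofReal (hint'.const_mul _)
    (ae_of_all _ fun x => by positivity), integral_const_mul]
  congr 1
  ring

theorem isBigO_toReal_of_le_ofReal_div {ι : Type*} {l : Filter ι} {F : ι → ℝ≥0∞} {r : ι → ℝ}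
    {c : ℝ} (hc : 0 ≤ c) (h : ∀ᶠ i in l, 0 ≤ r i ∧ F i ≤ ENNReal.ofReal (c / r i)) :
    (fun i => (F i).toReal) =O[l] fun i => 1 / r i := by
  refine IsBigO.of_bound c ?_
  filter_upwards [h] with i hi
  -- The bound is finite, so `toReal` does not hide an infinite value.
  have h0 : 0 ≤ c / r i := div_nonneg hc hi.1
  rw [Real.norm_of_nonneg ENNReal.toReal_nonneg, Real.norm_of_nonneg (by have := hi.1; positivity),
    mul_one_div]
  exact ENNReal.toReal_le_of_le_ofReal h0 hi.2

end Estimator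

theorem mainTheorem8 {d : ℕ} {Ω : Type*} [MeasurableSpace Ω] (μ : Measure Ω)
    [IsProbabilityMeasure μ]
    (P : Measure (EuclideanSpace ℝ (Fin d))) [IsProbabilityMeasure P]
    (p : EuclideanSpace ℝ (Fin d) → ℝ) (hp : IsSobolevDensity P p)
    (Z : ℕ → Ω → EuclideanSpace ℝ (Fin d))
    (hZ : IsIIDSample Z P μ ∨ IsStationaryChainWithGap Z P μ) :
    ∃ Cmc : ℝ, 0 < Cmc ∧
      ∀ (K : EuclideanSpace ℝ (Fin d) → ℝ) (h : ℕ → ℝ),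
        IsSmoothingKernel K → IsBandwidth d h →
        ((∀ N : ℕ, 1 ≤ N →
            integratedVariance μ P K (h N) Z N
              ≤ ENNReal.ofReal
                  (Cmc / ((N : ℝ) * h N ^ d) * (eLpNorm K 2 volume).toReal ^ 2)) ∧
          (fun N : ℕ => (integratedVariance μ P K (h N) Z N).toReal)
            =O[atTop] fun N : ℕ => 1 / ((N : ℝ) * h N ^ d)) ∧
        ∀ (m Cp : ℝ), 2 * (d : ℝ) < m → 0 < Cp →
          Integrable (fun u : EuclideanSpace ℝ (Fin d) => (1 + ‖u‖) ^ m * K u ^ 2) volume →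
          (∀ᵐ x : EuclideanSpace ℝ (Fin d), p x ≤ Cp * (1 + ‖x‖) ^ (-m)) →
          Integrable (fun x : EuclideanSpace ℝ (Fin d) => (1 + ‖x‖) ^ (-m / 2)) volume ∧
          (∀ N : ℕ, 1 ≤ N → h N < 1 →
            integratedMAD μ P K (h N) Z N
              ≤ ENNReal.ofReal
                  (√(Cmc * Cp * ∫ u : EuclideanSpace ℝ (Fin d), (1 + ‖u‖) ^ m * K u ^ 2)
                      * (∫ x : EuclideanSpace ℝ (Fin d), (1 + ‖x‖) ^ (-m / 2))
                    / (√(N : ℝ) * h N ^ ((d : ℝ) / 2)))) ∧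
          (fun N : ℕ => (integratedMAD μ P K (h N) Z N).toReal)
            =O[atTop] fun N : ℕ => 1 / (√(N : ℝ) * h N ^ ((d : ℝ) / 2)) := by
  obtain ⟨hZm, hZP, C, hC, hbound⟩ := exists_norm_sum_sampleIsometry_sq_le hZ
  have hb : MeanSquareBound C Z P μ := fun g hg N hN =>
    lintegral_sq_empiricalMean_sub_le hZm hZP hC hbound hg hN
  have hac : P ≪ volume := hp.density ▸ withDensity_absolutelyContinuous _ _
  have hpm : AEMeasurable p volume := hp.memW_two.1.1.aemeasurable
  refine ⟨C, hC, fun K h hK hh => ⟨?_, fun m Cp hm hCp hint hdecay => ?_⟩⟩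
  · have hvar : ∀ N : ℕ, 1 ≤ N → integratedVariance μ P K (h N) Z N ≤ ENNReal.ofReal
        (C / ((N : ℝ) * h N ^ d) * (eLpNorm K 2 volume).toReal ^ 2) := fun N hN =>
      integratedVariance_le hac hC hb hK.memLp_two (hh.pos N) hN
    refine ⟨hvar, isBigO_toReal_of_le_ofReal_div
      (c := C * (eLpNorm K 2 volume).toReal ^ 2) (by positivity) ?_⟩
    filter_upwards [eventually_ge_atTop 1] with N hN
    have := hh.pos N
    refine ⟨by positivity, (hvar N hN).trans_eq ?_⟩
    congr 1
    ring
  · have hm0 : 0 ≤ m := le_trans (by positivity) hm.le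
    have hint' : Integrable (fun x : EuclideanSpace ℝ (Fin d) => (1 + ‖x‖) ^ (-m / 2)) volume := by
      rw [neg_div]
      -- The exponent `m / 2` must exceed the dimension `d`, which is `m > 2d`.
      refine integrable_one_add_norm ?_
      rw [finrank_euclideanSpace_fin]
      linarith
    have hmad := fun (N : ℕ) (hN : 1 ≤ N) (hN1 : h N < 1) =>
      integratedMAD_le hZm hZP hpm hp.density hC hb hK.memLp_two.1.aemeasurable (hh.pos N) hN1 hm0
        hCp hint hdecay hint' hN
    have hI : 0 ≤ ∫ x : EuclideanSpace ℝ (Fin d), (1 + ‖x‖) ^ (-m / 2) :=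
      integral_nonneg fun x => by positivity
    refine ⟨hint', hmad, isBigO_toReal_of_le_ofReal_div
      (c := √(C * Cp * ∫ u : EuclideanSpace ℝ (Fin d), (1 + ‖u‖) ^ m * K u ^ 2)
        * ∫ x : EuclideanSpace ℝ (Fin d), (1 + ‖x‖) ^ (-m / 2))
      (mul_nonneg (Real.sqrt_nonneg _) hI) ?_⟩
    filter_upwards [eventually_ge_atTop 1, hh.tendsto_zero.eventually_lt_const one_pos]
      with N hN hN1
    have := hh.pos N
    exact ⟨by positivity, hmad N hN hN1⟩
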